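/- Let $\mathcal H$ be a finite-dimensional complex Hilbert space of dimension $d$, and let $(X,\mathcal F(X))$ be a measurable space. Let $\nu:\mathcal F(X)\to\mathcal B(\mathcal H)$ be a quantum probability measure, i.e. $\nu$ is countably additive, $\nu(E)\ge 0$ for all $E\in\mathcal F(X)$, $\nu(X)\neq 0$, and $\nu(X)=1$. Let $\mu=\frac1d\operatorname{tr}\circ\nu$ be the induced classical probability measure, and let $\frac{d\nu}{d\mu}:X\to\mathcal B(\mathcal H)$ be the principal Radon--Nikodym derivative, i.e. the ($\mu$-a.e. unique) measurable function with $\int_E \operatorname{tr}\big(\rho\,\frac{d\nu}{d\mu}\big)\,d\mu=\operatorname{tr}(\rho\,\nu(E))$ for all $E\in\mathcal F(X)$ and all density operators $\rho$. Let $L^\infty_{\mathcal H}(X,\nu)=L^\infty(X,\mu)\otimes\mathcal B(\mathcal H)$ be the unital $*$-algebra of $\mu$-essentially bounded measurable functions $X\to\mathcal B(\mathcal H)$ modulo equality $\mu$-a.e., and for $\psi\in L^\infty_{\mathcal H}(X,\nu)$ let $$\mathbb E_\nu[\psi]=\int_X\psi\,d\nu=\int_X\Big(\frac{d\nu}{d\mu}\Big)^{1/2}\psi\,\Big(\frac{d\nu}{d\mu}\Big)^{1/2}\,d\mu\in\mathcal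 B(\mathcal H)$$ be its quantum expectation. A minimal Stinespring dilation of $\mathbb E_\nu$ is a triple $(\mathcal K_\nu,\Delta_\nu,v)$ of a Hilbert space $\mathcal K_\nu$, a unital $*$-homomorphism $\Delta_\nu:L^\infty_{\mathcal H}(X,\nu)\to\mathcal B(\mathcal K_\nu)$ and an isometry $v:\mathcal H\to\mathcal K_\nu$ such that $\mathbb E_\nu[\psi]=v^*\Delta_\nu(\psi)v$ for every $\psi\in L^\infty_{\mathcal H}(X,\nu)$, and the linear span of $\{\Delta_\nu(\psi)v\xi:\psi\in L^\infty_{\mathcal H}(X,\nu),\ \xi\in\mathcal H\}$ is dense in $\mathcal K_\nu$. A subspace $\mathcal M$ of a Hilbert space $\mathcal K$ is semi-invariant for $z\in\mathcal B(\mathcal K)$ if $\mathcal M=\mathcal L_0^\perp\cap\mathcal L_1$ for some closed $z$-invariant subspaces $\mathcal L_0\subseteq\mathcal L_1$ of $\mathcal K$. **Theorem.** Let $\psi\in L^\infty_{\mathcal H}(X,\nu)$, let $g_k=\mathbb E_\nu[\psi^k]$ for $k=0,1,2,\dots$, and let $(\mathcal K_\nu,\Delta_\nu,v)$ be a minimal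 Stinespring dilation of $\mathbb E_\nu$. Then the following two statements are equivalent: 1. $g_k=(g_1)^k$ for every $k=0,1,2,\dots$; 2. $v(\mathcal H)$ is a semi-invariant subspace for $\Delta_\nu(\psi)$. -/

import Mathlib

open MeasureTheory
open scoped ENNReal ComplexOrder

set_option linter.unusedSectionVars false

noncomputable section

namespace QuantumMoments

/-! ### The star-algebra of almost-everywhere classes of measurable functions -/

section AEEqFunAlgebra

variable {X : Type*} [MeasurableSpace X] {μ : Measure X}

instance aeRing {B : Type*} [Ring B] [TopologicalSpace B] [IsTopologicalRing B] :
    Ring (X →ₘ[μ] B) where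
  __ := (inferInstance : AddCommGroup (X →ₘ[μ] B))
  __ := (inferInstance : Monoid (X →ₘ[μ] B))
  left_distrib f g h := by
    refine AEEqFun.induction_on₃ f g h fun f hf g hg h hh => ?_
    simp only [AEEqFun.mk_add_mk, AEEqFun.mk_mul_mk, mul_add]
  right_distrib f g h := by
    refine AEEqFun.induction_on₃ f g h fun f hf g hg h hh => ?_
    simp only [AEEqFun.mk_add_mk, AEEqFun.mk_mul_mk, add_mul]
  zero_mul f := by
    refine AEEqFun.induction_on f fun f hf => ?_
    rw [AEEqFun.zero_def, AEEqFun.mk_mul_mk]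
    exact AEEqFun.mk_eq_mk.2 (ae_of_all _ fun x => zero_mul _)
  mul_zero f := by
    refine AEEqFun.induction_on f fun f hf => ?_
    rw [AEEqFun.zero_def, AEEqFun.mk_mul_mk]
    exact AEEqFun.mk_eq_mk.2 (ae_of_all _ fun x => mul_zero _)

instance aeAlgebra {B : Type*} [Ring B] [TopologicalSpace B] [IsTopologicalRing B]
    [Algebra ℂ B] [ContinuousConstSMul ℂ B] : Algebra ℂ (X →ₘ[μ] B) :=
  Algebra.ofModule
    (fun c f g => by
      refine AEEqFun.induction_on₂ f g fun f hf g hg => ?_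
      simp only [AEEqFun.smul_mk, AEEqFun.mk_mul_mk, smul_mul_assoc])
    (fun c f g => by
      refine AEEqFun.induction_on₂ f g fun f hf g hg => ?_
      simp only [AEEqFun.smul_mk, AEEqFun.mk_mul_mk, mul_smul_comm])

instance aeStarRing {B : Type*} [Ring B] [TopologicalSpace B] [IsTopologicalRing B]
    [StarRing B] [ContinuousStar B] : StarRing (X →ₘ[μ] B) where
  star_mul f g := by
    apply AEEqFun.ext
    filter_upwards [AEEqFun.coeFn_star (f * g), AEEqFun.coeFn_mul f g,
      AEEqFun.coeFn_mul (star g) (star f), AEEqFun.coeFn_star f, AEEqFun.coeFn_star g]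
      with x h1 h2 h3 h4 h5
    simp [h1, h2, h3, h4, h5]
  star_add f g := by
    apply AEEqFun.ext
    filter_upwards [AEEqFun.coeFn_star (f + g), AEEqFun.coeFn_add f g,
      AEEqFun.coeFn_add (star f) (star g), AEEqFun.coeFn_star f, AEEqFun.coeFn_star g]
      with x h1 h2 h3 h4 h5
    simp [h1, h2, h3, h4, h5]

instance aeStarModule {B : Type*} [Ring B] [TopologicalSpace B] [IsTopologicalRing B]
    [StarRing B] [ContinuousStar B] [Algebra ℂ B] [ContinuousConstSMul ℂ B] [StarModule ℂ B] :
    StarModule ℂ (X →ₘ[μ] B) where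
  star_smul c f := by
    apply AEEqFun.ext
    filter_upwards [AEEqFun.coeFn_star (c • f), AEEqFun.coeFn_smul c f,
      AEEqFun.coeFn_smul (star c) (star f), AEEqFun.coeFn_star f] with x h1 h2 h3 h4
    rw [h1, h3]
    simp only [Pi.star_apply, Pi.smul_apply, h2, h4, star_smul]

end AEEqFunAlgebra

/-! ### Quantum probability measures -/

section Measures

variable {X : Type*} [MeasurableSpace X]
variable {H : Type*} [NormedAddCommGroup H] [InnerProductSpace ℂ H] [CompleteSpace H]

/-- The canonical (unnormalised) trace on `B(H)`, for finite-dimensional `H`. -/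
def tr (T : H →L[ℂ] H) : ℂ := LinearMap.trace ℂ H (T : H →ₗ[ℂ] H)

/-- A positive operator-valued measure with values in `B(H)`. For finite-dimensional `H`, countable
additivity in norm, as in Mathlib's `VectorMeasure`, is the same as ultraweak countable
additivity. Positivity refers to the Loewner order. -/
structure POVM (X H : Type*) [MeasurableSpace X] [NormedAddCommGroup H] [InnerProductSpace ℂ H]
    [CompleteSpace H] where
  /-- the underlying operator-valued measure -/
  toVectorMeasure : VectorMeasure X (H →L[ℂ] H)
  nonneg : ∀ E, MeasurableSet E → 0 ≤ toVectorMeasure E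
  ne_zero : toVectorMeasure Set.univ ≠ 0

/-- A quantum probability measure: a positive operator-valued measure of total mass `1`. -/
structure QuantumProbabilityMeasure (X H : Type*) [MeasurableSpace X] [NormedAddCommGroup H]
    [InnerProductSpace ℂ H] [CompleteSpace H] extends POVM X H where
  map_univ : toVectorMeasure Set.univ = 1

variable [FiniteDimensional ℂ H]

theorem continuous_tr : Continuous (tr : (H →L[ℂ] H) → ℂ) :=
  LinearMap.continuous_of_finiteDimensional
    ((LinearMap.trace ℂ H).comp (ContinuousLinearMap.coeLM ℂ) : (H →L[ℂ] H) →ₗ[ℂ] ℂ)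

/-- The normalised trace `T ↦ (1 / d) Re (tr T)` as an additive map. -/
def normTr : (H →L[ℂ] H) →+ ℝ where
  toFun T := (tr T).re / Module.finrank ℂ H
  map_zero' := by simp [tr]
  map_add' S T := by simp [tr, add_div]

theorem continuous_normTr : Continuous (normTr : (H →L[ℂ] H) →+ ℝ) :=
  (Complex.continuous_re.comp continuous_tr).div_const _

theorem tr_nonneg {T : H →L[ℂ] H} (hT : 0 ≤ T) : 0 ≤ tr T :=
  ((ContinuousLinearMap.nonneg_iff_isPositive T).1 hT).toLinearMap.trace_nonneg

theorem normTr_nonneg {T : H →L[ℂ] H} (hT : 0 ≤ T) : 0 ≤ normTr T :=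
  div_nonneg (Complex.nonneg_iff.1 (tr_nonneg hT)).1 (Nat.cast_nonneg _)

theorem normTr_mapRange_nonneg (ν : QuantumProbabilityMeasure X H) :
    VectorMeasure.restrict 0 Set.univ ≤
      (ν.toVectorMeasure.mapRange normTr continuous_normTr : SignedMeasure X).restrict
        Set.univ := by
  refine VectorMeasure.restrict_le_restrict_of_subset_le _ _ fun E hE _ => ?_
  simpa using normTr_nonneg (ν.nonneg E hE)

/-- The classical probability measure `μ = (1 / d) tr ∘ ν` induced by `ν`. -/
def inducedMeasure (ν : QuantumProbabilityMeasure X H) : Measure X :=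
  SignedMeasure.toMeasureOfZeroLE (ν.toVectorMeasure.mapRange normTr continuous_normTr)
    Set.univ MeasurableSet.univ (normTr_mapRange_nonneg ν)

theorem inducedMeasure_real (ν : QuantumProbabilityMeasure X H) {E : Set X}
    (hE : MeasurableSet E) :
    (inducedMeasure ν).real E = (tr (ν.toVectorMeasure E)).re / Module.finrank ℂ H := by
  rw [inducedMeasure, SignedMeasure.toMeasureOfZeroLE_real_apply _ _ _ hE, Set.univ_inter]
  rfl

instance inducedMeasure_isProbability (ν : QuantumProbabilityMeasure X H) :
    IsProbabilityMeasure (inducedMeasure ν) := by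
  have : IsFiniteMeasure (inducedMeasure ν) := by unfold inducedMeasure; infer_instance
  have hd : (Module.finrank ℂ H : ℝ) ≠ 0 := by
    intro h
    have h0 : Module.finrank ℂ H = 0 := by exact_mod_cast h
    have := Module.finrank_zero_iff.1 h0
    exact ν.ne_zero (Subsingleton.elim _ _)
  refine ⟨?_⟩
  rw [← ENNReal.toReal_eq_one_iff]
  have := inducedMeasure_real ν MeasurableSet.univ
  rw [ν.map_univ] at this
  have h1 : tr (1 : H →L[ℂ] H) = Module.finrank ℂ H := LinearMap.trace_one ℂ H
  rw [h1] at this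
  rw [← measureReal_def, this]
  simp [hd]

/-! ### The principal Radon-Nikodym derivative -/

/-- Density operators: positive operators of trace one. -/
def IsDensityOperator (ρ : H →L[ℂ] H) : Prop := 0 ≤ ρ ∧ tr ρ = 1

/-- `D` is a principal Radon-Nikodym derivative of `ν` with respect to the induced classical
measure `μ`: it is measurable and integrable, and `∫_E tr (ρ D) dμ = tr (ρ ν(E))` for all
measurable `E` and all density operators `ρ`. -/
structure IsPrincipalRNDeriv (ν : QuantumProbabilityMeasure X H) (D : X → H →L[ℂ] H) : Prop where
  measurable : Measurable D
  integrable : Integrable D (inducedMeasure ν)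
  setIntegral : ∀ E, MeasurableSet E → ∀ ρ : H →L[ℂ] H, IsDensityOperator ρ →
    ∫ x in E, tr (ρ * D x) ∂(inducedMeasure ν) = tr (ρ * ν.toVectorMeasure E)

theorem eq_zero_of_tr_re_eq_zero {T : H →L[ℂ] H} (hT : 0 ≤ T) (h : (tr T).re = 0) : T = 0 := by
  have hp := (ContinuousLinearMap.nonneg_iff_isPositive T).1 hT
  have h0 : tr T = 0 :=
    Complex.ext h (Complex.nonneg_iff.1 (tr_nonneg hT)).2.symm
  have b := stdOrthonormalBasis ℂ H
  have hM := (LinearMap.posSemidef_toMatrix_iff b).2 hp.toLinearMap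
  rw [tr, LinearMap.trace_eq_matrix_trace ℂ b.toBasis, hM.trace_eq_zero_iff] at h0
  have := (LinearMap.toMatrix b.toBasis b.toBasis).map_eq_zero_iff.1 h0
  exact ContinuousLinearMap.coe_injective this

theorem eq_zero_of_inducedMeasure_eq_zero (ν : QuantumProbabilityMeasure X H) {E : Set X}
    (hE : MeasurableSet E) (h : inducedMeasure ν E = 0) : ν.toVectorMeasure E = 0 := by
  have h1 := inducedMeasure_real ν hE
  rw [measureReal_def, h, ENNReal.toReal_zero, eq_comm, div_eq_zero_iff] at h1
  rcases h1 with h1 | h1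
  · exact eq_zero_of_tr_re_eq_zero (ν.nonneg E hE) h1
  · have h0 : Module.finrank ℂ H = 0 := by exact_mod_cast h1
    have := Module.finrank_zero_iff.1 h0
    exact Subsingleton.elim _ _

/-- Scalar Radon-Nikodym theorem for the image of `ν` under a continuous real functional. -/
theorem exists_density_real (ν : QuantumProbabilityMeasure X H) (φ : (H →L[ℂ] H) →L[ℝ] ℝ) :
    ∃ f : X → ℝ, Measurable f ∧ Integrable f (inducedMeasure ν) ∧
      ∀ E, MeasurableSet E → ∫ x in E, f x ∂(inducedMeasure ν) = φ (ν.toVectorMeasure E) := by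
  let s : SignedMeasure X := ν.toVectorMeasure.mapRange (φ : (H →L[ℂ] H) →+ ℝ) φ.continuous
  have hs : s ≪ᵥ (inducedMeasure ν).toENNRealVectorMeasure := by
    refine VectorMeasure.AbsolutelyContinuous.mk fun E hE h => ?_
    rw [Measure.toENNRealVectorMeasure_apply_measurable hE] at h
    change φ (ν.toVectorMeasure E) = 0
    rw [eq_zero_of_inducedMeasure_eq_zero ν hE h, map_zero]
  refine ⟨s.rnDeriv (inducedMeasure ν), SignedMeasure.measurable_rnDeriv _ _,
    SignedMeasure.integrable_rnDeriv _ _, fun E hE => ?_⟩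
  have := SignedMeasure.withDensityᵥ_rnDeriv_eq s (inducedMeasure ν) hs
  rw [← withDensityᵥ_apply (SignedMeasure.integrable_rnDeriv s (inducedMeasure ν)) hE, this]
  rfl

theorem exists_isPrincipalRNDeriv (ν : QuantumProbabilityMeasure X H) :
    ∃ D : X → H →L[ℂ] H, IsPrincipalRNDeriv ν D := by
  have : FiniteDimensional ℝ (H →L[ℂ] H) := FiniteDimensional.trans ℝ ℂ (H →L[ℂ] H)
  let b := Module.finBasis ℝ (H →L[ℂ] H)
  choose f hfm hfi hf using fun i =>
    exists_density_real ν (LinearMap.toContinuousLinearMap (b.coord i))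
  have hint : Integrable (fun x => ∑ i, f i x • b i) (inducedMeasure ν) :=
    integrable_finsetSum _ fun i _ => (hfi i).smul_const (b i)
  refine ⟨fun x => ∑ i, f i x • b i, ?_, hint, fun E hE ρ _ => ?_⟩
  · exact Finset.measurable_sum _ fun i _ => (hfm i).smul_const (b i)
  · have hE' : ∫ x in E, (∑ i, f i x • b i) ∂(inducedMeasure ν) = ν.toVectorMeasure E := by
      rw [integral_finsetSum _ fun i _ => ((hfi i).smul_const (b i)).integrableOn]
      simp_rw [integral_smul_const, hf _ E hE]
      exact b.sum_repr _
    let φ : (H →L[ℂ] H) →L[ℂ] ℂ := LinearMap.toContinuousLinearMap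
      (((LinearMap.trace ℂ H).comp (ContinuousLinearMap.coeLM ℂ)).comp (LinearMap.mulLeft ℂ ρ))
    have := φ.integral_comp_comm hint.integrableOn (μ := (inducedMeasure ν).restrict E)
    rw [hE'] at this
    exact this

/-- The principal Radon-Nikodym derivative `dν/dμ` (unique up to `μ`-null sets). -/
def rnDeriv (ν : QuantumProbabilityMeasure X H) : X → H →L[ℂ] H :=
  (exists_isPrincipalRNDeriv ν).choose

theorem rnDeriv_spec (ν : QuantumProbabilityMeasure X H) : IsPrincipalRNDeriv ν (rnDeriv ν) :=
  (exists_isPrincipalRNDeriv ν).choose_spec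

/-! ### Essentially bounded quantum random variables and quantum expectation -/

/-- `L^∞_H(X, ν)`: the unital star-algebra of classes, modulo equality `μ`-almost everywhere, of
measurable `μ`-essentially bounded functions `X → B(H)`, with the pointwise operations. -/
def LInfty (ν : QuantumProbabilityMeasure X H) :
    StarSubalgebra ℂ (X →ₘ[inducedMeasure ν] (H →L[ℂ] H)) where
  carrier := {f | MemLp f ∞ (inducedMeasure ν)}
  mul_mem' {f g} hf hg := (hg.mul hf (r := ∞)).ae_eq (AEEqFun.coeFn_mul f g).symm
  add_mem' {f g} hf hg := (hf.add hg).ae_eq (AEEqFun.coeFn_add f g).symm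
  algebraMap_mem' c := by
    have h : MemLp (fun _ : X => c • (1 : H →L[ℂ] H)) ∞ (inducedMeasure ν) := memLp_const _
    refine h.ae_eq ?_
    rw [Algebra.algebraMap_eq_smul_one]
    filter_upwards [AEEqFun.coeFn_smul c (1 : X →ₘ[inducedMeasure ν] (H →L[ℂ] H)),
      AEEqFun.coeFn_one (α := X) (μ := inducedMeasure ν) (β := H →L[ℂ] H)] with x h1 h2
    simp [h1, h2]
  star_mem' {f} hf := hf.star.ae_eq (AEEqFun.coeFn_star f).symm

/-- The weighted integrand `(dν/dμ)^{1/2} ψ (dν/dμ)^{1/2}`. -/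
def weighted (ν : QuantumProbabilityMeasure X H) (ψ : X → H →L[ℂ] H) (x : X) : H →L[ℂ] H :=
  CFC.sqrt (rnDeriv ν x) * ψ x * CFC.sqrt (rnDeriv ν x)

/-- The quantum expectation `E_ν[ψ] = ∫ ψ dν = ∫ (dν/dμ)^{1/2} ψ (dν/dμ)^{1/2} dμ`. -/
def expectation (ν : QuantumProbabilityMeasure X H) (ψ : LInfty ν) : H →L[ℂ] H :=
  ∫ x, weighted ν (ψ : X →ₘ[inducedMeasure ν] (H →L[ℂ] H)) x ∂(inducedMeasure ν)

theorem aestronglyMeasurable_sqrt_rnDeriv (ν : QuantumProbabilityMeasure X H) :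
    AEStronglyMeasurable (fun x => CFC.sqrt (rnDeriv ν x)) (inducedMeasure ν) := by
  have hproper : ProperSpace (H →L[ℂ] H) := FiniteDimensional.proper ℂ _
  have hsqrt : Measurable (CFC.sqrt : (H →L[ℂ] H) → (H →L[ℂ] H)) := by
    refine measurable_of_restrict_of_restrict_compl (s := {a : H →L[ℂ] H | 0 ≤ a})
      isClosed_Ici.measurableSet ?_ ?_
    · exact (continuousOn_iff_continuous_domRestrict.1 CFC.continuousOn_sqrt).measurable
    · have : Set.domRestrict {a : H →L[ℂ] H | 0 ≤ a}ᶜ CFC.sqrt = fun _ => 0 := by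
        ext1 a
        exact cfcₙ_apply_of_not_predicate _ a.2
      rw [this]
      exact measurable_const
  exact (hsqrt.comp (rnDeriv_spec ν).measurable).aestronglyMeasurable

/-- The weighted integrand is integrable, so that the integral above is a genuine one. -/
theorem integrable_weighted (ν : QuantumProbabilityMeasure X H) (ψ : LInfty ν) :
    Integrable (weighted ν (ψ : X →ₘ[inducedMeasure ν] (H →L[ℂ] H))) (inducedMeasure ν) := by
  have hs := aestronglyMeasurable_sqrt_rnDeriv ν
  have hψ : MemLp (ψ : X →ₘ[inducedMeasure ν] (H →L[ℂ] H)) ∞ (inducedMeasure ν) := ψ.2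
  obtain ⟨C, hC⟩ : ∃ C : ℝ, ∀ᵐ x ∂(inducedMeasure ν),
      ‖(ψ : X →ₘ[inducedMeasure ν] (H →L[ℂ] H)) x‖ ≤ C := by
    have htop := hψ.eLpNorm_lt_top
    rw [eLpNorm_exponent_top] at htop
    refine ⟨(eLpNormEssSup (ψ : X →ₘ[inducedMeasure ν] (H →L[ℂ] H))
      (inducedMeasure ν)).toReal, ?_⟩
    filter_upwards [ae_le_eLpNormEssSup (μ := inducedMeasure ν)
      (f := (ψ : X →ₘ[inducedMeasure ν] (H →L[ℂ] H)))] with x hx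
    simpa using ENNReal.toReal_mono htop.ne hx
  refine ((rnDeriv_spec ν).integrable.norm.const_mul C).mono'
    ((hs.mul hψ.1).mul hs) ?_
  filter_upwards [hC] with x hx
  have hC0 : 0 ≤ C := (norm_nonneg _).trans hx
  have hsq : ‖CFC.sqrt (rnDeriv ν x)‖ * ‖CFC.sqrt (rnDeriv ν x)‖ ≤ ‖rnDeriv ν x‖ := by
    by_cases h : 0 ≤ rnDeriv ν x
    · rw [CFC.norm_sqrt _ h, Real.mul_self_sqrt (norm_nonneg _)]
    · have : CFC.sqrt (rnDeriv ν x) = 0 := cfcₙ_apply_of_not_predicate _ h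
      simp [this]
  calc ‖weighted ν _ x‖
      ≤ ‖CFC.sqrt (rnDeriv ν x)‖ * _ * ‖CFC.sqrt (rnDeriv ν x)‖ :=
        (norm_mul_le _ _).trans (mul_le_mul_of_nonneg_right (norm_mul_le _ _) (norm_nonneg _))
    _ = _ * (‖CFC.sqrt (rnDeriv ν x)‖ * ‖CFC.sqrt (rnDeriv ν x)‖) := by ring
    _ ≤ C * ‖rnDeriv ν x‖ := mul_le_mul hx hsq (by positivity) hC0

/-- The quantum expectation is the operator determined by
`tr (ρ E_ν[ψ]) = ∫ tr (ρ (dν/dμ)^{1/2} ψ (dν/dμ)^{1/2}) dμ` for all density operators `ρ`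
(and indeed for all operators `ρ`). -/
theorem tr_mul_expectation (ν : QuantumProbabilityMeasure X H) (ψ : LInfty ν)
    (ρ : H →L[ℂ] H) :
    tr (ρ * expectation ν ψ) =
      ∫ x, tr (ρ * weighted ν (ψ : X →ₘ[inducedMeasure ν] (H →L[ℂ] H)) x)
        ∂(inducedMeasure ν) := by
  let φ : (H →L[ℂ] H) →L[ℂ] ℂ := LinearMap.toContinuousLinearMap
    (((LinearMap.trace ℂ H).comp (ContinuousLinearMap.coeLM ℂ)).comp (LinearMap.mulLeft ℂ ρ))
  exact (φ.integral_comp_comm (integrable_weighted ν ψ)).symm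

/-! ### Minimal Stinespring dilations and semi-invariant subspaces -/

variable {K : Type*} [NormedAddCommGroup K] [InnerProductSpace ℂ K] [CompleteSpace K]

/-- `(K, Δ, v)` is a minimal Stinespring dilation of the quantum expectation `E_ν`: here `v` is an
isometry and `Δ` a unital star-homomorphism. -/
structure IsMinimalStinespringDilation (ν : QuantumProbabilityMeasure X H)
    (Δ : LInfty ν →⋆ₐ[ℂ] (K →L[ℂ] K)) (v : H →ₗᵢ[ℂ] K) : Prop where
  dilation : ∀ ψ : LInfty ν, expectation ν ψ =
    ContinuousLinearMap.adjoint v.toContinuousLinearMap ∘L Δ ψ ∘L v.toContinuousLinearMap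
  minimal : Dense (Submodule.span ℂ {y : K | ∃ (ψ : LInfty ν) (ξ : H), y = Δ ψ (v ξ)} : Set K)

end Measures

/-- A subspace `M` of a Hilbert space `K` is semi-invariant for an operator `z` if it is the
orthogonal difference `L₁ ⊖ L₀ = L₀ᗮ ∩ L₁` of two closed `z`-invariant subspaces `L₀ ⊆ L₁`. -/
def IsSemiInvariant {K : Type*} [NormedAddCommGroup K] [InnerProductSpace ℂ K]
    (M : Submodule ℂ K) (z : K →L[ℂ] K) : Prop :=
  ∃ L₀ L₁ : Submodule ℂ K, IsClosed (L₀ : Set K) ∧ IsClosed (L₁ : Set K) ∧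
    (∀ x ∈ L₀, z x ∈ L₀) ∧ (∀ x ∈ L₁, z x ∈ L₁) ∧ L₀ ≤ L₁ ∧ M = L₀ᗮ ⊓ L₁

end QuantumMoments

end

namespace QuantumMoments

open ContinuousLinearMap (adjoint)

variable {H : Type*} [NormedAddCommGroup H] [InnerProductSpace ℂ H] [CompleteSpace H]
variable {K : Type*} [NormedAddCommGroup K] [InnerProductSpace ℂ K] [CompleteSpace K]

/-! Write `z = Δ ψ` and `a = v* z v`. Since `Δ` is multiplicative, the dilation identity gives `g k
= v* z^k v`, so the claim becomes Sarason's lemma for a single operator: `v* z^k v = a^k` for all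
`k` iff `v(H)` is semi-invariant for `z`. Both directions rest on the intertwining relation `v* z =
a v*` on `L₁`. If `v(H) = L₁ ⊖ L₀`, it holds because `v*` kills `L₀` and `z` preserves `L₀`;
iterating it along the orbit of `v ξ` gives the powers (`compression_pow_of_isSemiInvariant`).
Conversely, let `L₁` be the closed span of the orbits `z^k v ξ`. The moment identities are this
relation on the generators, and it makes `L₀ = L₁ ∩ ker v*` invariant
(`isSemiInvariant_of_compression_pow`). -/

theorem adjoint_isometry_apply (v : H →ₗᵢ[ℂ] K) (ξ : H) :
    adjoint v.toContinuousLinearMap (v ξ) = ξ := by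
  refine ext_inner_right ℂ fun η => ?_
  rw [ContinuousLinearMap.adjoint_inner_left]
  exact v.inner_map_map ξ η

/-- This is `ker v* = v(H)ᗮ`. One direction shows that `v*` kills `L₀`, the other that `v(H)` lies
in `L₀ᗮ`. -/
theorem adjoint_isometry_eq_zero_iff (v : H →ₗᵢ[ℂ] K) (x : K) :
    adjoint v.toContinuousLinearMap x = 0 ↔ ∀ ξ, inner ℂ x (v ξ) = 0 := by
  have h : ∀ ξ, inner ℂ (adjoint v.toContinuousLinearMap x) ξ = inner ℂ x (v ξ) := fun ξ =>
    ContinuousLinearMap.adjoint_inner_left _ _ _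
  refine ⟨fun hx ξ => by rw [← h, hx, inner_zero_left], fun hx => ?_⟩
  refine ext_inner_right ℂ fun η => ?_
  rw [h, hx, inner_zero_left]

/-- The compressions of the powers of `z` to a semi-invariant subspace are the powers of its
compression. -/
theorem compression_pow_of_isSemiInvariant (v : H →ₗᵢ[ℂ] K) (z : K →L[ℂ] K)
    (h : IsSemiInvariant (LinearMap.range v.toLinearMap) z) (k : ℕ) (ξ : H) :
    adjoint v.toContinuousLinearMap ((z ^ k) (v ξ)) =
      ((adjoint v.toContinuousLinearMap ∘L z ∘L v.toContinuousLinearMap) ^ k) ξ := by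
  obtain ⟨L₀, L₁, hc₀, -, hz₀, hz₁, hle, hM⟩ := h
  have : CompleteSpace L₀ := hc₀.completeSpace_coe
  have hv : ∀ η, v η ∈ L₀ᗮ ⊓ L₁ := fun η => hM ▸ LinearMap.mem_range_self v.toLinearMap η
  have hker : ∀ x ∈ L₀, adjoint v.toContinuousLinearMap x = 0 := fun x hx =>
    (adjoint_isometry_eq_zero_iff v x).2 fun η => (hv η).1 x hx
  -- Split `x = p + q` along the closed subspace `L₀`. Then `q` is in `L₁ ⊖ L₀ = v(H)`, while `p`
  -- and `z p` stay in `L₀` and contribute nothing under `v*`.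
  have key : ∀ x ∈ L₁, adjoint v.toContinuousLinearMap (z x) =
      adjoint v.toContinuousLinearMap (z (v (adjoint v.toContinuousLinearMap x))) := by
    intro x hx
    obtain ⟨p, hp, q, hq, rfl⟩ := L₀.exists_add_mem_mem_orthogonal x
    have hqM : q ∈ LinearMap.range v.toLinearMap := by
      rw [hM]
      exact ⟨hq, (L₁.add_mem_iff_right (hle hp)).1 hx⟩
    obtain ⟨η, rfl⟩ := hqM
    change adjoint v.toContinuousLinearMap (z (p + v η)) = adjoint v.toContinuousLinearMap
      (z (v (adjoint v.toContinuousLinearMap (p + v η))))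
    rw [map_add, map_add, map_add, hker p hp, hker _ (hz₀ p hp), adjoint_isometry_apply,
      zero_add, zero_add]
  -- The orbit never leaves `L₁`, so `key` applies at each power.
  have hmem : ∀ k, (z ^ k) (v ξ) ∈ L₁ := by
    intro k
    induction k with
    | zero => exact (hv ξ).2
    | succ k ih => rw [pow_succ']; exact hz₁ _ ih
  induction k with
  | zero => exact adjoint_isometry_apply v ξ
  | succ k ih =>
    rw [pow_succ', pow_succ', mul_apply_eq_comp, key _ (hmem k), ih]
    rfl

/-- If the compressions of the powers of `z` are the powers of its compression, then the range of
the isometry is semi-invariant. -/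
theorem isSemiInvariant_of_compression_pow (v : H →ₗᵢ[ℂ] K) (z : K →L[ℂ] K)
    (h : ∀ (k : ℕ) (ξ : H), adjoint v.toContinuousLinearMap ((z ^ k) (v ξ)) =
      ((adjoint v.toContinuousLinearMap ∘L z ∘L v.toContinuousLinearMap) ^ k) ξ) :
    IsSemiInvariant (LinearMap.range v.toLinearMap) z := by
  set w := adjoint v.toContinuousLinearMap with hw
  set a := w ∘L z ∘L v.toContinuousLinearMap with ha
  -- `S` is the smallest `z`-invariant subspace containing `v(H)`.
  let S : Submodule ℂ K := Submodule.span ℂ {y | ∃ (k : ℕ) (ξ : H), y = (z ^ k) (v ξ)}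
  let L₁ := S.topologicalClosure
  have hSz : ∀ x ∈ S, z x ∈ S := by
    have : S ≤ S.comap (z : K →ₗ[ℂ] K) := Submodule.span_le.2 (by
      rintro _ ⟨k, ξ, rfl⟩
      exact Submodule.subset_span ⟨k + 1, ξ, by rw [pow_succ']; rfl⟩)
    exact this
  have hz₁ : ∀ x ∈ L₁, z x ∈ L₁ := fun x hx =>
    map_mem_closure z.continuous hx hSz
  have hv₁ : ∀ ξ, v ξ ∈ L₁ := fun ξ =>
    S.le_topologicalClosure (Submodule.subset_span ⟨0, ξ, rfl⟩)
  -- At a generator `z^k v ξ` both sides equal `a^(k+1) ξ`, by the hypothesis at `k + 1` and at `k`.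
  -- Continuity extends the equality to the closure.
  have key : ∀ x ∈ L₁, w (z x) = a (w x) := by
    have hS : S ≤ LinearMap.ker ((w ∘L z - a ∘L w : K →L[ℂ] H) : K →ₗ[ℂ] H) :=
      Submodule.span_le.2 (by
        rintro _ ⟨k, ξ, rfl⟩
        change w (z ((z ^ k) (v ξ))) - a (w ((z ^ k) (v ξ))) = 0
        have := h (k + 1) ξ
        rw [pow_succ', pow_succ'] at this
        rw [h k, sub_eq_zero]
        exact this)
    intro x hx
    exact sub_eq_zero.1 (S.topologicalClosure_minimal hS
      (w ∘L z - a ∘L w : K →L[ℂ] H).isClosed_ker hx)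
  have hwv : ∀ ξ, w (v ξ) = ξ := adjoint_isometry_apply v
  -- `L₀` is the part of `L₁` orthogonal to `v(H)`, the only possible choice once `L₁` is fixed.
  refine ⟨L₁ ⊓ LinearMap.ker (w : K →ₗ[ℂ] H), L₁, ?_, S.isClosed_topologicalClosure, ?_, hz₁,
    inf_le_left, ?_⟩
  · exact S.isClosed_topologicalClosure.inter w.isClosed_ker
  · rintro x ⟨hx, hx0⟩
    refine ⟨hz₁ x hx, ?_⟩
    have hx0 : w x = 0 := hx0
    change w (z x) = 0
    rw [key x hx, hx0, map_zero]
  · have hv₀ : ∀ ξ, v ξ ∈ (L₁ ⊓ LinearMap.ker (w : K →ₗ[ℂ] H))ᗮ := fun ξ x hx =>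
      (adjoint_isometry_eq_zero_iff v x).1 hx.2 ξ
    apply le_antisymm
    · rintro _ ⟨ξ, rfl⟩
      exact ⟨hv₀ ξ, hv₁ ξ⟩
    · rintro x ⟨hx₀, hx₁⟩
      -- `v w` is the orthogonal projection onto `v(H)`. The residual `x - v (w x)` lies in `L₀`,
      -- and also in `L₀ᗮ` because `x` and `v (w x)` do, so it vanishes.
      have hmem : x - v (w x) ∈ L₁ ⊓ LinearMap.ker (w : K →ₗ[ℂ] H) := by
        refine ⟨L₁.sub_mem hx₁ (hv₁ _), ?_⟩
        change w (x - v (w x)) = 0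
        rw [map_sub, hwv, sub_self]
      have h0 : x - v (w x) = 0 := inner_self_eq_zero.1
        (Submodule.sub_mem _ hx₀ (hv₀ (w x)) _ hmem)
      exact ⟨w x, (sub_eq_zero.1 h0).symm⟩

end QuantumMoments

theorem mainTheorem5 {X : Type*} [MeasurableSpace X]
    {H : Type*} [NormedAddCommGroup H] [InnerProductSpace ℂ H] [CompleteSpace H]
    [FiniteDimensional ℂ H]
    (ν : QuantumMoments.QuantumProbabilityMeasure X H) (ψ : QuantumMoments.LInfty ν)
    (g : ℕ → (H →L[ℂ] H)) (hg : ∀ k, g k = QuantumMoments.expectation ν (ψ ^ k))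
    {K : Type*} [NormedAddCommGroup K] [InnerProductSpace ℂ K] [CompleteSpace K]
    (Δ : QuantumMoments.LInfty ν →⋆ₐ[ℂ] (K →L[ℂ] K)) (v : H →ₗᵢ[ℂ] K)
    (hΔ : QuantumMoments.IsMinimalStinespringDilation ν Δ v) :
    (∀ k, g k = g 1 ^ k) ↔
      QuantumMoments.IsSemiInvariant (LinearMap.range v.toLinearMap) (Δ ψ) := by
  -- Multiplicativity of `Δ` turns moments of `ψ` into compressed powers of `Δ ψ`.
  have hpow : ∀ k ξ, g k ξ = ContinuousLinearMap.adjoint v.toContinuousLinearMap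
      ((Δ ψ ^ k) (v ξ)) := by
    intro k ξ
    rw [hg, hΔ.dilation, map_pow]
    rfl
  have hone : g 1 = ContinuousLinearMap.adjoint v.toContinuousLinearMap ∘L Δ ψ ∘L
      v.toContinuousLinearMap := by
    rw [hg, hΔ.dilation, pow_one]
  constructor
  · intro h
    refine QuantumMoments.isSemiInvariant_of_compression_pow v (Δ ψ) fun k ξ => ?_
    rw [← hpow, ← hone, h]
  · intro h k
    ext ξ
    rw [hpow, hone]
    exact QuantumMoments.compression_pow_of_isSemiInvariant v (Δ ψ) h k ξ
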